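/- Let $A$ be a (complex, not necessarily unital) $C^*$-algebra, let $I\subseteq A$ be a two-sided ideal of the algebra $A$ (a linear subspace with $AI\subseteq I$ and $IA\subseteq I$, not necessarily closed), and let $T:A\to A$ be an elementary operator, i.e. there are $N\in\mathbb N$ and $a_1,\dots,a_N,b_1,\dots,b_N\in A$ with $$Tx=\sum_{i=1}^N a_i\,x\,b_i\qquad (x\in A).$$ Then $\overline{T(I)}$ is an M-ideal in the Banach space $\overline{T(A)}$ (closures in norm). Here a closed subspace $Y$ of a Banach space $X$ is called an L-summand of $X$ if there is a subspace $Z\subseteq X$ with $X=Y\oplus Z$ and $\|y+z\|=\|y\|+\|z\|$ for all $y\in Y$, $z\in Z$; and a closed subspace $Y$ of $X$ is called an M-ideal in $X$ if its annihilator $Y^{\perp}=\{f\in X^*: f(y)=0 \text{ for all } y\in Y\}$ is an L-summand of the dual space $X^*$. -/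

import Mathlib

/-- A closed subspace `Y` of a normed space `X` is an *L-summand* if `X = Y ⊕ Z` for some subspace
`Z` with `‖y + z‖ = ‖y‖ + ‖z‖` for all `y ∈ Y`, `z ∈ Z`. -/
def IsLSummand {𝕜 X : Type*} [NontriviallyNormedField 𝕜] [NormedAddCommGroup X] [NormedSpace 𝕜 X]
    (Y : Submodule 𝕜 X) : Prop :=
  IsClosed (Y : Set X) ∧
    ∃ Z : Submodule 𝕜 X, IsCompl Y Z ∧ ∀ y ∈ Y, ∀ z ∈ Z, ‖y + z‖ = ‖y‖ + ‖z‖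

/-- A closed subspace `Y` of a normed space `X` is an *M-ideal* in `X` if its annihilator is an
L-summand of the dual space `X*` (with the operator norm). For a subspace `Y`, the polar
`StrongDual.polarSubmodule 𝕜 Y` is the annihilator `{f ∈ X* | ∀ y ∈ Y, f y = 0}`,
see `StrongDual.mem_polarSubmodule`. -/
def IsMIdeal {𝕜 X : Type*} [NontriviallyNormedField 𝕜] [NormedAddCommGroup X] [NormedSpace 𝕜 X]
    (Y : Submodule 𝕜 X) : Prop :=
  IsClosed (Y : Set X) ∧ IsLSummand (StrongDual.polarSubmodule 𝕜 Y)

/-- `Y` and `X` being subspaces of an ambient normed space `E`: `Y` is contained in `X` and is an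
M-ideal in the normed space `X`. -/
def IsMIdealIn {𝕜 E : Type*} [NontriviallyNormedField 𝕜] [NormedAddCommGroup E] [NormedSpace 𝕜 E]
    (Y X : Submodule 𝕜 E) : Prop :=
  Y ≤ X ∧ IsMIdeal (Y.submoduleOf X)

/-- A linear operator on a (not necessarily unital) algebra `A` is *elementary* if it is of the
form `x ↦ ∑ i, a i * x * b i`, a finite sum with `a i, b i ∈ A`. -/
def IsElementaryOperator {𝕜 A : Type*} [CommSemiring 𝕜] [NonUnitalRing A] [Module 𝕜 A]
    (T : A →ₗ[𝕜] A) : Prop :=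
  ∃ (N : ℕ) (a b : Fin N → A), ∀ x, T x = ∑ i, a i * x * b i

/-! Let `e` be a quasi-central approximate unit of `A` lying in `I`, with `0 ≤ e ≤ 1`, and put `S x
= e x e`, `R x = (1 - e) x (1 - e)`. Cauchy-Schwarz gives `‖S x + R z‖ ≤ max ‖x‖ ‖z‖`, the norm
inequality behind M-ideals. Since `e` asymptotically commutes with the coefficients of `T`, `S (T
x)` is close to `T (e x e)`, and `T x - R (T x)` to `T (e x + x e - e x e)`; both arguments of `T`
lie in `I`. So `S` and `id - R` map the closure of `T(A)` asymptotically into that of `T(I)`, where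
`S` tends to the identity. By duality, `f ↦ lim F ∘ S`, with `F` any extension of `f` to `A`, is the
L-projection whose kernel is the annihilator: `isMIdealIn_of_asymptotic_decomposition`. The net
comes from `CStarAlgebra.exists_quasicentral_net`, and the commutation from
`IsElementaryOperator.tendsto_sub`. -/

open Filter Topology

/-! ### Limits of functionals and a criterion for M-ideals -/

/-- A bounded net of functionals converges pointwise along an ultrafilter. -/
theorem StrongDual.exists_tendsto_ultrafilter {𝕜 E ι : Type*} [NontriviallyNormedField 𝕜]
    [ProperSpace 𝕜] [SeminormedAddCommGroup E] [NormedSpace 𝕜 E] (U : Ultrafilter ι)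
    (F : ι → StrongDual 𝕜 E) (C : ℝ) (hF : ∀ i, ‖F i‖ ≤ C) :
    ∃ g : StrongDual 𝕜 E, ∀ x, Tendsto (fun i => F i x) U (𝓝 (g x)) := by
  have hc := WeakDual.isCompact_closedBall (0 : StrongDual 𝕜 E) C
  obtain ⟨g, -, hg⟩ := hc.ultrafilter_le_nhds (U.map fun i => StrongDual.toWeakDual (F i)) (by
    rw [le_principal_iff]
    refine mem_map.2 (Eventually.of_forall fun i => ?_)
    simpa using hF i)
  refine ⟨WeakDual.toStrongDual g, fun x => ?_⟩
  have h : Tendsto (fun i => StrongDual.toWeakDual (F i)) U (𝓝 g) := hg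
  exact ((WeakDual.eval_continuous x).tendsto g).comp h

/-- A functional that vanishes on `Y` tends to `0` along nets whose distance to `Y` does. -/
theorem StrongDual.tendsto_zero_of_infDist {𝕜 E ι : Type*} [NontriviallyNormedField 𝕜]
    [NormedAddCommGroup E] [NormedSpace 𝕜 E] {l : Filter ι} {Y : Submodule 𝕜 E}
    {F : StrongDual 𝕜 E} (hF : ∀ y ∈ Y, F y = 0) {u : ι → E}
    (hu : Tendsto (fun i => Metric.infDist (u i) (Y : Set E)) l (𝓝 0)) :
    Tendsto (fun i => F (u i)) l (𝓝 0) := by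
  have key : ∀ v, ‖F v‖ ≤ (‖F‖ + 1) * Metric.infDist v (Y : Set E) := by
    intro v
    have hpos : 0 < ‖F‖ + 1 := by positivity
    rw [← div_le_iff₀' hpos]
    refine (Metric.le_infDist ⟨0, Y.zero_mem⟩).2 fun y hy => ?_
    rw [div_le_iff₀' hpos, dist_eq_norm]
    have h1 : F v = F (v - y) := by rw [map_sub, hF y hy, sub_zero]
    rw [h1]
    exact (F.le_opNorm _).trans (by gcongr; linarith)
  refine squeeze_zero_norm (fun i => key (u i)) ?_
  simpa using hu.const_mul (‖F‖ + 1)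

theorem StrongDual.exists_re_gt {𝕜 E : Type*} [RCLike 𝕜] [NormedAddCommGroup E] [NormedSpace 𝕜 E]
    (f : StrongDual 𝕜 E) {r : ℝ} (hr : r < ‖f‖) :
    ∃ x, ‖x‖ ≤ 1 ∧ r < RCLike.re (f x) := by
  obtain ⟨x, hx, hrx⟩ := f.exists_lt_apply_of_lt_opNorm hr
  obtain ⟨c, hc, hcx⟩ := RCLike.exists_norm_eq_mul_self (f x)
  refine ⟨c • x, by rw [norm_smul, hc, one_mul]; exact hx.le, ?_⟩
  rw [map_smul, smul_eq_mul, ← hcx, RCLike.ofReal_re]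
  exact hrx

/-- If operators `S i` and `R i` satisfy `‖S i x + R i z‖ ≤ max ‖x‖ ‖z‖`, then limits `g` of
`F ∘ S i` and `k` of `F ∘ R i` on a subspace satisfy `‖g‖ + ‖k‖ ≤ ‖F‖`. -/
theorem StrongDual.norm_add_norm_le_of_tendsto {𝕜 E ι : Type*} [RCLike 𝕜]
    [NormedAddCommGroup E] [NormedSpace 𝕜 E] {l : Filter ι} [l.NeBot] {X : Submodule 𝕜 E}
    {S R : ι → E →L[𝕜] E} (hSR : ∀ i x z, ‖S i x + R i z‖ ≤ max ‖x‖ ‖z‖)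
    {F : StrongDual 𝕜 E} {g k : StrongDual 𝕜 X}
    (hg : ∀ x : X, Tendsto (fun i => F (S i x)) l (𝓝 (g x)))
    (hk : ∀ x : X, Tendsto (fun i => F (R i x)) l (𝓝 (k x))) :
    ‖g‖ + ‖k‖ ≤ ‖F‖ := by
  refine le_of_forall_lt fun r hr => ?_
  obtain ⟨r₁, h₁, r₂, h₂, h⟩ : ∃ r₁ < ‖g‖, ∃ r₂ < ‖k‖, r ≤ r₁ + r₂ :=
    ⟨‖g‖ - (‖g‖ + ‖k‖ - r) / 2, by linarith, ‖k‖ - (‖g‖ + ‖k‖ - r) / 2, by linarith, by linarith⟩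
  obtain ⟨x, hx, hgx⟩ := g.exists_re_gt h₁
  obtain ⟨z, hz, hkz⟩ := k.exists_re_gt h₂
  have hle : ‖g x + k z‖ ≤ ‖F‖ := by
    refine le_of_tendsto ((hg x).add (hk z)).norm (Eventually.of_forall fun i => ?_)
    rw [← map_add]
    refine (F.le_opNorm _).trans (mul_le_of_le_one_right (norm_nonneg _) ?_)
    exact (hSR i x z).trans (max_le hx hz)
  have := (RCLike.re_le_norm (g x + k z)).trans hle
  rw [map_add] at this
  linarith

/-- The operators need not preserve `X`, so functionals on `X` are first extended to `E`. The choice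
of extension is harmless: `S i x` and `x - R i x` approach `Y`, so the limits see only the values on
`Y`. Norm-preserving extensions then make the norms add. -/
theorem isMIdealIn_of_asymptotic_decomposition {𝕜 E ι : Type*} [RCLike 𝕜]
    [NormedAddCommGroup E] [NormedSpace 𝕜 E] {l : Filter ι} [l.NeBot] {Y X : Submodule 𝕜 E}
    (hY : IsClosed (Y : Set E)) (hYX : Y ≤ X) {S R : ι → E →L[𝕜] E}
    (hSR : ∀ i x z, ‖S i x + R i z‖ ≤ max ‖x‖ ‖z‖)
    (hSX : ∀ x ∈ X, Tendsto (fun i => Metric.infDist (S i x) (Y : Set E)) l (𝓝 0))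
    (hRX : ∀ x ∈ X, Tendsto (fun i => Metric.infDist (x - R i x) (Y : Set E)) l (𝓝 0))
    (hSY : ∀ y ∈ Y, Tendsto (fun i => S i y) l (𝓝 y)) :
    IsMIdealIn Y X := by
  -- A single ultrafilter serves all functionals, so that the limits exist simultaneously and depend
  -- linearly on `F`.
  set U : Ultrafilter ι := Ultrafilter.of l
  have hU : (U : Filter ι) ≤ l := Ultrafilter.of_le l
  have hS : ∀ i, ‖S i‖ ≤ 1 := fun i => (S i).opNorm_le_bound zero_le_one fun x => by
    simpa using hSR i x 0
  have hR : ∀ i, ‖R i‖ ≤ 1 := fun i => (R i).opNorm_le_bound zero_le_one fun x => by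
    simpa using hSR i 0 x
  have exS : ∀ F : StrongDual 𝕜 E, ∃ g : StrongDual 𝕜 X,
      ∀ x : X, Tendsto (fun i => F (S i x)) U (𝓝 (g x)) := fun F =>
    StrongDual.exists_tendsto_ultrafilter U (fun i => (F ∘L S i) ∘L X.subtypeL) ‖F‖ fun i =>
      ContinuousLinearMap.opNorm_le_bound _ (norm_nonneg _) fun x => by
        refine (F.le_opNorm _).trans (mul_le_mul_of_nonneg_left ?_ (norm_nonneg _))
        simpa using (S i).le_of_opNorm_le (hS i) x
  have exR : ∀ F : StrongDual 𝕜 E, ∃ g : StrongDual 𝕜 X,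
      ∀ x : X, Tendsto (fun i => F (R i x)) U (𝓝 (g x)) := fun F =>
    StrongDual.exists_tendsto_ultrafilter U (fun i => (F ∘L R i) ∘L X.subtypeL) ‖F‖ fun i =>
      ContinuousLinearMap.opNorm_le_bound _ (norm_nonneg _) fun x => by
        refine (F.le_opNorm _).trans (mul_le_mul_of_nonneg_left ?_ (norm_nonneg _))
        simpa using (R i).le_of_opNorm_le (hR i) x
  have memY : ∀ f : StrongDual 𝕜 X, f ∈ StrongDual.polarSubmodule 𝕜 (Y.submoduleOf X) ↔
      ∀ (y : E) (hy : y ∈ Y), f ⟨y, hYX hy⟩ = 0 := fun f => by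
    rw [StrongDual.mem_polarSubmodule]
    exact ⟨fun h y hy => h ⟨y, hYX hy⟩ hy, fun h y hy => h y hy⟩
  have restrS : ∀ {F : StrongDual 𝕜 E} {g : StrongDual 𝕜 X},
      (∀ x : X, Tendsto (fun i => F (S i x)) U (𝓝 (g x))) →
      ∀ (y : E) (hy : y ∈ Y), g ⟨y, hYX hy⟩ = F y := fun {F g} h y hy =>
    tendsto_nhds_unique (h ⟨y, hYX hy⟩) ((F.continuous.tendsto y).comp ((hSY y hy).mono_left hU))
  -- the limits depend only on the restriction to `Y`
  have congrS : ∀ {F G : StrongDual 𝕜 E} {g : StrongDual 𝕜 X}, (∀ y ∈ Y, F y = G y) →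
      (∀ x : X, Tendsto (fun i => F (S i x)) U (𝓝 (g x))) →
      ∀ x : X, Tendsto (fun i => G (S i x)) U (𝓝 (g x)) := fun {F G g} hFG h x => by
    have := StrongDual.tendsto_zero_of_infDist (F := G - F) (Y := Y)
      (fun y hy => by simp [hFG y hy]) ((hSX x x.2).mono_left hU)
    simpa using (h x).add this
  have congrR : ∀ {F G : StrongDual 𝕜 E} {g : StrongDual 𝕜 X}, (∀ y ∈ Y, F y = G y) →
      (∀ x : X, Tendsto (fun i => F (x - R i x)) U (𝓝 (g x))) →
      ∀ x : X, Tendsto (fun i => G (x - R i x)) U (𝓝 (g x)) := fun {F G g} hFG h x => by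
    have := StrongDual.tendsto_zero_of_infDist (F := G - F) (Y := Y)
      (fun y hy => by simp [hFG y hy]) ((hRX x x.2).mono_left hU)
    simpa using (h x).add this
  -- the main norm estimate
  have key : ∀ {H : StrongDual 𝕜 E} {h g g' : StrongDual 𝕜 X}, (∀ x : X, H x = h x) →
      (∀ x : X, Tendsto (fun i => H (S i x)) U (𝓝 (g x))) →
      (∀ x : X, Tendsto (fun i => H (x - R i x)) U (𝓝 (g' x))) → ‖g‖ + ‖h - g'‖ ≤ ‖H‖ :=
    fun {H h g g'} hH hg hg' => StrongDual.norm_add_norm_le_of_tendsto hSR hg fun x => by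
      simpa [hH] using (hg' x).const_sub (h x)
  -- `id - R` has the same limit as `S`: for a norm-preserving extension of `g`, the estimate `key`
  -- reads `‖g‖ + ‖g - g'‖ ≤ ‖g‖`, where `g'` is the limit along `id - R`.
  have limR : ∀ {F : StrongDual 𝕜 E} {g : StrongDual 𝕜 X},
      (∀ x : X, Tendsto (fun i => F (S i x)) U (𝓝 (g x))) →
      ∀ x : X, Tendsto (fun i => F (x - R i x)) U (𝓝 (g x)) := fun {F g} hg => by
    obtain ⟨k, hk⟩ := exR F
    obtain ⟨G, hG, hGn⟩ := exists_extension_norm_eq X g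
    have hFG : ∀ y ∈ Y, F y = G y := fun y hy =>
      (restrS hg y hy).symm.trans (hG ⟨y, hYX hy⟩).symm
    have hg' : ∀ x : X, Tendsto (fun i => F (x - R i x)) U
        (𝓝 ((F ∘L X.subtypeL - k) x)) := fun x => by
      simpa using (hk x).const_sub (F x)
    have := key hG (congrS hFG hg) (congrR hFG hg')
    rw [hGn] at this
    have h0 : g = F ∘L X.subtypeL - k :=
      sub_eq_zero.1 (norm_le_zero_iff.1 (by linarith))
    rwa [← h0] at hg'
  let Z : Submodule 𝕜 (StrongDual 𝕜 X) :=
    { carrier := {g | ∃ F : StrongDual 𝕜 E, ∀ x : X, Tendsto (fun i => F (S i x)) U (𝓝 (g x))}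
      zero_mem' := ⟨0, fun x => by simp⟩
      add_mem' := by
        rintro g k ⟨F, hF⟩ ⟨G, hG⟩
        exact ⟨F + G, fun x => by simpa using (hF x).add (hG x)⟩
      smul_mem' := by
        rintro c g ⟨F, hF⟩
        exact ⟨c • F, fun x => by simpa using (hF x).const_mul c⟩ }
  refine ⟨hYX, hY.preimage continuous_subtype_val, ?_, Z, ⟨?_, ?_⟩, ?_⟩
  · have : (StrongDual.polarSubmodule 𝕜 (Y.submoduleOf X) : Set (StrongDual 𝕜 X)) =
        ⋂ (y : E) (hy : y ∈ Y), {f | f ⟨y, hYX hy⟩ = 0} := by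
      ext f
      simpa using memY f
    rw [this]
    refine isClosed_iInter fun y => isClosed_iInter fun hy => ?_
    exact isClosed_eq (ContinuousLinearMap.apply 𝕜 𝕜 (⟨y, hYX hy⟩ : X)).continuous
      continuous_const
  · rw [Submodule.disjoint_def]
    rintro g hg ⟨F, hF⟩
    have hF0 : ∀ y ∈ Y, F y = (0 : StrongDual 𝕜 E) y := fun y hy =>
      (restrS hF y hy).symm.trans ((memY g).1 hg y hy)
    ext x
    exact tendsto_nhds_unique (congrS hF0 hF x) (by simp)
  · rw [codisjoint_iff, eq_top_iff]
    rintro f -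
    obtain ⟨F, hF, -⟩ := exists_extension_norm_eq X f
    obtain ⟨g, hg⟩ := exS F
    refine Submodule.mem_sup.2 ⟨f - g, (memY _).2 fun y hy => ?_, g, ⟨F, hg⟩, sub_add_cancel _ _⟩
    rw [sub_apply, restrS hg y hy, ← hF, sub_self]
  · rintro f hf g ⟨F, hF⟩
    refine le_antisymm (norm_add_le _ _) ?_
    -- Since `f` vanishes on `Y`, `H` and `F` agree there, so both limits for `H` are `g`, and `key`
    -- bounds `‖g‖ + ‖(f + g) - g‖`.
    obtain ⟨H, hH, hHn⟩ := exists_extension_norm_eq X (f + g)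
    have hFH : ∀ y ∈ Y, F y = H y := fun y hy => by
      rw [hH ⟨y, hYX hy⟩, add_apply, (memY f).1 hf y hy, zero_add,
        restrS hF y hy]
    have := key hH (congrS hFH hF) (congrR hFH (limR hF))
    rw [hHn, add_sub_cancel_right] at this
    linarith

/-! ### Quasi-central approximate units in C⋆-algebras -/

section CStarAlgebra

variable {B : Type*} [CStarAlgebra B] [PartialOrder B] [StarOrderedRing B]

open WithCStarModule in
/-- Cauchy-Schwarz in the Hilbert module `B × B`. -/
theorem CStarAlgebra.norm_mul_star_add_mul_star_sq_le (u₁ u₂ v₁ v₂ : B) :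
    ‖v₁ * star u₁ + v₂ * star u₂‖ ^ 2 ≤
      ‖u₁ * star u₁ + u₂ * star u₂‖ * ‖v₁ * star v₁ + v₂ * star v₂‖ := by
  let u : C⋆ᵐᵒᵈ(B, B × B) := (equiv B (B × B)).symm (u₁, u₂)
  let v : C⋆ᵐᵒᵈ(B, B × B) := (equiv B (B × B)).symm (v₁, v₂)
  have h := CStarModule.norm_inner_le (A := B) C⋆ᵐᵒᵈ(B, B × B) (x := u) (y := v)
  calc _ ≤ (‖u‖ * ‖v‖) ^ 2 := pow_le_pow_left₀ (norm_nonneg _) h 2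
    _ = ‖u‖ ^ 2 * ‖v‖ ^ 2 := mul_pow _ _ _
    _ = _ := by rw [prod_norm_sq, prod_norm_sq]; rfl

/-- Cauchy-Schwarz for the pairs `(e, d)` and `(e x, d z)`, `d = 1 - e`: both factors are controlled
by `e² + d² = 1 - 2(e - e²) ≤ 1`. -/
theorem CStarAlgebra.norm_conjugate_add_conjugate_le_max {e : B} (he₀ : 0 ≤ e) (he₁ : e ≤ 1)
    (x z : B) : ‖e * x * e + (1 - e) * z * (1 - e)‖ ≤ max ‖x‖ ‖z‖ := by
  set m := max ‖x‖ ‖z‖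
  have hm : 0 ≤ m := (norm_nonneg x).trans (le_max_left _ _)
  have hes : star e = e := (IsSelfAdjoint.of_nonneg he₀).star_eq
  set d := 1 - e with hd
  have hd₀ : 0 ≤ d := sub_nonneg.2 he₁
  have hds : star d = d := (IsSelfAdjoint.of_nonneg hd₀).star_eq
  have hsq : e * e + d * d ≤ 1 := by
    have h2 : e ^ 2 ≤ e ^ 1 := CStarAlgebra.pow_antitone he₀ he₁ one_le_two
    have h3 : e * e + d * d = 1 - 2 • (e ^ 1 - e ^ 2) := by rw [hd]; noncomm_ring
    rw [h3]
    exact sub_le_self _ (nsmul_nonneg (sub_nonneg.2 h2) 2)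
  have hsq0 : 0 ≤ e * e + d * d := add_nonneg
    (by simpa [hes] using mul_star_self_nonneg e) (by simpa [hds] using mul_star_self_nonneg d)
  have hn : ‖e * e + d * d‖ ≤ 1 := (CStarAlgebra.norm_le_one_iff_of_nonneg _ hsq0).2 hsq
  have conj : ∀ c y : B, star c = c → ‖y‖ ≤ m →
      (c * y) * star (c * y) ≤ (m ^ 2) • (c * c) := fun c y hc hy => by
    have h1 : y * star y ≤ algebraMap ℝ B (m ^ 2) :=
      CStarAlgebra.mul_star_le_algebraMap_norm_sq.trans
        (algebraMap_mono B (pow_le_pow_left₀ (norm_nonneg y) hy 2))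
    have := star_right_conjugate_le_conjugate h1 c
    rw [hc] at this
    simpa [hc, mul_assoc, Algebra.algebraMap_eq_smul_one] using this
  have h := CStarAlgebra.norm_mul_star_add_mul_star_sq_le e d (e * x) (d * z)
  have hv : ‖(e * x) * star (e * x) + (d * z) * star (d * z)‖ ≤ m ^ 2 := by
    have hle := add_le_add (conj e x hes (le_max_left _ _)) (conj d z hds (le_max_right _ _))
    rw [← smul_add] at hle
    refine (CStarAlgebra.norm_le_norm_of_nonneg_of_le
      (add_nonneg (mul_star_self_nonneg _) (mul_star_self_nonneg _)) hle).trans ?_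
    rw [norm_smul, Real.norm_of_nonneg (by positivity)]
    exact mul_le_of_le_one_right (by positivity) hn
  rw [hes, hds] at h
  refine (sq_le_sq₀ (norm_nonneg _) hm).1 ?_
  exact h.trans ((mul_le_of_le_one_left (norm_nonneg _) hn).trans hv)

/-- A right ideal, not necessarily closed, contains approximate left units `0 ≤ e ≤ 1`. -/
theorem CStarAlgebra.exists_approx_left_unit (I : Submodule ℂ B)
    (hr : ∀ a : B, ∀ x ∈ I, x * a ∈ I) (F : Finset B) {ε : ℝ} (hε : 0 < ε) :
    ∃ e ∈ I, 0 ≤ e ∧ e ≤ 1 ∧ ∀ y ∈ F, y ∈ I → ‖y - e * y‖ ≤ ε := by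
  classical
  set p : B := ∑ y ∈ F with y ∈ I, y * star y
  have hp0 : 0 ≤ p := Finset.sum_nonneg fun y _ => mul_star_self_nonneg y
  have hpI : p ∈ I := I.sum_mem fun y hy => hr _ _ (Finset.mem_filter.1 hy).2
  have hyp : ∀ y ∈ F, y ∈ I → y * star y ≤ p := fun y hy hyI =>
    Finset.single_le_sum (f := fun y => y * star y) (fun y _ => mul_star_self_nonneg y)
      (Finset.mem_filter.2 ⟨hy, hyI⟩)
  clear_value p
  have hps : IsSelfAdjoint p := .of_nonneg hp0
  set δ := ε ^ 2
  have hδ0 : 0 < δ := by positivity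
  have hspec : ∀ t ∈ spectrum ℝ p, 0 ≤ t := fun t ht => spectrum_nonneg_of_nonneg hp0 ht
  have hne : ∀ t ∈ spectrum ℝ p, t + δ ≠ 0 := fun t ht => by have := hspec t ht; positivity
  have hc : ContinuousOn (fun t : ℝ => (t + δ)⁻¹) (spectrum ℝ p) :=
    (continuousOn_id.add continuousOn_const).inv₀ hne
  -- `e = p (p + δ)⁻¹` has the factor `p ∈ I`, so `e` lies in `I` itself and no closure is needed.
  set e : B := cfc (fun t : ℝ => t * (t + δ)⁻¹) p with he
  have hce : ContinuousOn (fun t : ℝ => t * (t + δ)⁻¹) (spectrum ℝ p) :=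
    continuousOn_id.mul hc
  have hcd : ContinuousOn (fun t : ℝ => 1 - t * (t + δ)⁻¹) (spectrum ℝ p) :=
    continuousOn_const.sub hce
  have hpe : e = p * cfc (fun t : ℝ => (t + δ)⁻¹) p := by
    rw [he, cfc_mul (fun t : ℝ => t) _ p continuousOn_id hc, cfc_id' ℝ p hps]
  have he0 : 0 ≤ e := cfc_nonneg fun t ht => by have := hspec t ht; positivity
  have he1 : e ≤ 1 := cfc_le_one _ _ fun t ht => by
    have := hspec t ht
    rw [← div_eq_mul_inv, div_le_one (by positivity)]; linarith
  refine ⟨e, hpe ▸ hr _ _ hpI, he0, he1, fun y hy hyI => ?_⟩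
  set d := 1 - e with hd
  have hds : star d = d := (IsSelfAdjoint.of_nonneg (sub_nonneg.2 he1)).star_eq
  have hdc : d = cfc (fun t : ℝ => 1 - t * (t + δ)⁻¹) p := by
    rw [cfc_sub (fun _ : ℝ => 1) _ p continuousOn_const hce, cfc_const_one ℝ p hps]
  -- On the spectrum this is `δ² t / (t + δ)² ≤ δ`. As `y y* ≤ p`, it bounds `‖d y‖²` by `δ = ε²`.
  have hdpd : ‖d * p * d‖ ≤ δ := by
    have : d * p * d = cfc (fun t : ℝ => (1 - t * (t + δ)⁻¹) * t * (1 - t * (t + δ)⁻¹)) p := by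
      rw [cfc_mul (fun t : ℝ => (1 - t * (t + δ)⁻¹) * t) _ p
        (hcd.mul continuousOn_id) hcd, cfc_mul _ (fun t : ℝ => t) p hcd continuousOn_id, ← hdc,
        cfc_id' ℝ p hps]
    rw [this]
    refine norm_cfc_le hδ0.le fun t ht => ?_
    have h0 := hspec t ht
    have h1 : 1 - t * (t + δ)⁻¹ = δ / (t + δ) := by field_simp; ring
    rw [h1, Real.norm_of_nonneg (by positivity)]
    have h2 : δ / (t + δ) * t * (δ / (t + δ)) = δ * ((t * δ) / (t + δ) ^ 2) := by
      field_simp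
    rw [h2]
    refine mul_le_of_le_one_right hδ0.le ((div_le_one (by positivity)).2 ?_)
    nlinarith
  have hdy : ‖d * y‖ ^ 2 ≤ δ := by
    have h1 := star_right_conjugate_le_conjugate (hyp y hy hyI) d
    rw [hds] at h1
    have h2 : d * (y * star y) * d = (d * y) * star (d * y) := by
      rw [star_mul, hds]; noncomm_ring
    rw [h2] at h1
    have := CStarAlgebra.norm_le_norm_of_nonneg_of_le (mul_star_self_nonneg _) h1
    rw [CStarRing.norm_self_mul_star, ← sq] at this
    exact this.trans hdpd
  have : y - e * y = d * y := by rw [hd, sub_mul, one_mul]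
  rw [this]
  exact (sq_le_sq₀ (norm_nonneg _) hε.le).1 hdy

/-- A two-sided ideal, not necessarily closed, contains quasi-central approximate units: sums of
approximate units chosen successively have almost orthogonal commutators. -/
theorem CStarAlgebra.exists_quasicentral_sum (I : Submodule ℂ B)
    (hl : ∀ a : B, ∀ x ∈ I, a * x ∈ I) (hr : ∀ a : B, ∀ x ∈ I, x * a ∈ I) (F : Finset B) {ε C : ℝ}
    (hε : 0 < ε) (hC : 0 ≤ C) (hFC : ∀ a ∈ F, ‖a‖ ≤ C) (n : ℕ) :
    ∃ s ∈ I, 0 ≤ s ∧ s ≤ n • (1 : B) ∧ (∀ y ∈ F, y ∈ I → ‖n • y - s * y‖ ≤ n * ε) ∧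
      ∀ a ∈ F, ‖a * s - s * a‖ ^ 2 ≤ n * (4 * C ^ 2 + 1) := by
  classical
  induction n with
  | zero => exact ⟨0, I.zero_mem, le_rfl, by simp, by simp, by simp⟩
  | succ n ih =>
    obtain ⟨s, hsI, hs0, hs1, hsF, hsc⟩ := ih
    -- The second bound keeps the two cross terms of `(c + d)* (c + d)`, each at most `(1 + C) η`,
    -- below `1` in total.
    set η := min ε (1 / (2 * (1 + C)))
    have hη : 0 < η := lt_min hε (by positivity)
    have hηC : 2 * ((1 + C) * η) ≤ 1 := by
      calc 2 * ((1 + C) * η) ≤ 2 * ((1 + C) * (1 / (2 * (1 + C)))) := by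
            gcongr; exact min_le_right _ _
        _ = 1 := by field_simp
    obtain ⟨e, heI, he0, he1, heF⟩ := CStarAlgebra.exists_approx_left_unit I hr
      (F ∪ F.image (fun a => a * s - s * a) ∪ F.image (fun a => star a * (a * s - s * a))) hη
    have hes : star e = e := (IsSelfAdjoint.of_nonneg he0).star_eq
    have hen : ‖e‖ ≤ 1 := (CStarAlgebra.norm_le_one_iff_of_nonneg e he0).2 he1
    refine ⟨s + e, I.add_mem hsI heI, add_nonneg hs0 he0, ?_, fun y hy hyI => ?_, fun a ha => ?_⟩
    · rw [succ_nsmul]; exact add_le_add hs1 he1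
    · have h1 : (n + 1) • y - (s + e) * y = (n • y - s * y) + (y - e * y) := by
        rw [succ_nsmul, add_mul]; abel
      rw [h1]
      push_cast
      rw [add_mul, one_mul]
      exact (norm_add_le _ _).trans (add_le_add (hsF y hy hyI)
        ((heF y (by simp [hy]) hyI).trans (min_le_left _ _)))
    · set c := a * s - s * a with hc
      set d := a * e - e * a with hd
      have hcI : c ∈ I := I.sub_mem (hl _ _ hsI) (hr _ _ hsI)
      have h1 : ‖c - e * c‖ ≤ η := heF c (by
        simp only [Finset.mem_union, Finset.mem_image]; exact .inl (.inr ⟨a, ha, rfl⟩)) hcI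
      have h2 : ‖star a * c - e * (star a * c)‖ ≤ η := heF _ (by
        simp only [Finset.mem_union, Finset.mem_image]; exact .inr ⟨a, ha, rfl⟩) (hl _ _ hcI)
      have haC := hFC a ha
      -- The old commutator `c` lies in `I`, so `e` could be chosen to almost fix `c` and `a* c`
      -- from the left; this makes `d* c` small.
      have hdc : ‖star d * c‖ ≤ (1 + C) * η := by
        have : star d * c = star a * (c - e * c) - (star a * c - e * (star a * c)) := by
          rw [hd, star_sub, star_mul, star_mul, hes]; noncomm_ring
        rw [this]
        refine (norm_sub_le _ _).trans ?_
        have h3 : ‖star a * (c - e * c)‖ ≤ C * η :=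
          (norm_mul_le _ _).trans (mul_le_mul (by rwa [norm_star]) h1 (norm_nonneg _) hC)
        linarith
      have hcd : ‖star c * d‖ ≤ (1 + C) * η := by
        rw [← norm_star, star_mul, star_star]; exact hdc
      have hdn : ‖d‖ ≤ 2 * C := by
        refine (norm_sub_le _ _).trans ?_
        have h3 := (norm_mul_le a e).trans (mul_le_mul haC hen (norm_nonneg _) hC)
        have h4 := (norm_mul_le e a).trans (mul_le_mul hen haC (norm_nonneg _) zero_le_one)
        linarith
      have hsum : a * (s + e) - (s + e) * a = c + d := by rw [hc, hd]; noncomm_ring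
      have hexp : star (c + d) * (c + d) = star c * c + star d * d + (star d * c + star c * d) := by
        rw [star_add]; noncomm_ring
      rw [hsum, sq, ← CStarRing.norm_star_mul_self, hexp]
      have hcn : ‖star c * c‖ ≤ n * (4 * C ^ 2 + 1) := by
        rw [CStarRing.norm_star_mul_self, ← sq]; exact hsc a ha
      have hdd : ‖star d * d‖ ≤ 4 * C ^ 2 := by
        rw [CStarRing.norm_star_mul_self]
        nlinarith [norm_nonneg d]
      have h5 := (norm_add_le (star c * c + star d * d) (star d * c + star c * d)).trans
        (add_le_add (norm_add_le _ _) (norm_add_le _ _))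
      push_cast
      linarith

/-- The commutators of a sum of `n` approximate units grow only like `√n`, so those of the average
are `O(1/√n)`. -/
theorem CStarAlgebra.exists_quasicentral_approx_unit (I : Submodule ℂ B)
    (hl : ∀ a : B, ∀ x ∈ I, a * x ∈ I) (hr : ∀ a : B, ∀ x ∈ I, x * a ∈ I) (F : Finset B) {ε : ℝ}
    (hε : 0 < ε) :
    ∃ e ∈ I, 0 ≤ e ∧ e ≤ 1 ∧ (∀ y ∈ F, y ∈ I → ‖y - e * y‖ ≤ ε) ∧
      ∀ a ∈ F, ‖a * e - e * a‖ ≤ ε := by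
  set C : ℝ := ∑ a ∈ F, ‖a‖
  have hC : 0 ≤ C := Finset.sum_nonneg fun a _ => norm_nonneg a
  have hFC : ∀ a ∈ F, ‖a‖ ≤ C := fun a ha =>
    Finset.single_le_sum (f := fun a => ‖a‖) (fun a _ => norm_nonneg a) ha
  obtain ⟨n, hn⟩ := exists_nat_ge ((4 * C ^ 2 + 1) / ε ^ 2 + 1)
  have hn0 : (0 : ℝ) < n := lt_of_lt_of_le (by positivity) hn
  have hnε : 4 * C ^ 2 + 1 ≤ n * ε ^ 2 := by
    rw [← div_le_iff₀ (by positivity)]; linarith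
  obtain ⟨s, hsI, hs0, hs1, hsF, hsc⟩ :=
    CStarAlgebra.exists_quasicentral_sum I hl hr F hε hC hFC n
  have hinv : 0 ≤ (n : ℝ)⁻¹ := by positivity
  have hns : ∀ y : B, (n : ℝ)⁻¹ • (n • y) = y := fun y => by
    rw [← Nat.cast_smul_eq_nsmul ℝ, smul_smul, inv_mul_cancel₀ hn0.ne', one_smul]
  refine ⟨(n : ℝ)⁻¹ • s, I.smul_of_tower_mem _ hsI, smul_nonneg hinv hs0, ?_,
    fun y hy hyI => ?_, fun a ha => ?_⟩
  · have := smul_le_smul_of_nonneg_left hs1 hinv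
    rwa [hns] at this
  · have h1 : y - (n : ℝ)⁻¹ • s * y = (n : ℝ)⁻¹ • (n • y - s * y) := by
      rw [smul_sub, hns, smul_mul_assoc]
    rw [h1, norm_smul, Real.norm_of_nonneg hinv, inv_mul_le_iff₀ hn0]
    exact hsF y hy hyI
  · have h1 : a * (n : ℝ)⁻¹ • s - (n : ℝ)⁻¹ • s * a = (n : ℝ)⁻¹ • (a * s - s * a) := by
      rw [smul_sub, smul_mul_assoc, mul_smul_comm]
    rw [h1, norm_smul, Real.norm_of_nonneg hinv, inv_mul_le_iff₀ hn0]
    refine (sq_le_sq₀ (norm_nonneg _) (by positivity)).1 ((hsc a ha).trans ?_)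
    calc (n : ℝ) * (4 * C ^ 2 + 1) ≤ n * (n * ε ^ 2) := by gcongr
      _ = (n * ε) ^ 2 := by ring

end CStarAlgebra

/-- A two-sided ideal of a C⋆-algebra, not necessarily closed, contains a net `e` which is a
quasi-central approximate unit with `0 ≤ e ≤ 1` in the unitization. -/
theorem CStarAlgebra.exists_quasicentral_net {A : Type*} [NonUnitalCStarAlgebra A]
    (I : Submodule ℂ A) (hl : ∀ a : A, ∀ x ∈ I, a * x ∈ I) (hr : ∀ a : A, ∀ x ∈ I, x * a ∈ I) :
    ∃ e : Finset A × ℕ → A, (∀ i, e i ∈ I) ∧ (∀ i, ‖e i‖ ≤ 1) ∧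
      (∀ i x z, ‖e i * x * e i + (z - e i * z - z * e i + e i * z * e i)‖ ≤ max ‖x‖ ‖z‖) ∧
      (∀ y ∈ I, Tendsto (fun i => e i * y) atTop (𝓝 y)) ∧
      ∀ a, Tendsto (fun i => a * e i - e i * a) atTop (𝓝 0) := by
  classical
  let := CStarAlgebra.spectralOrder (Unitization ℂ A)
  have := CStarAlgebra.spectralOrderedRing (Unitization ℂ A)
  let J : Submodule ℂ (Unitization ℂ A) := I.map (Unitization.inrHom ℂ ℂ A)
  have hJ : ∀ x : A, (x : Unitization ℂ A) ∈ J ↔ x ∈ I := fun x =>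
    ⟨by rintro ⟨y, hy, hyx⟩; rwa [← Unitization.inr_injective hyx], fun hx => ⟨x, hx, rfl⟩⟩
  have hJl : ∀ b : Unitization ℂ A, ∀ x ∈ J, b * x ∈ J := by
    rintro b _ ⟨x, hx, rfl⟩
    induction b with
    | inl_add_inr r a =>
      refine ⟨r • x + a * x, I.add_mem (I.smul_mem r hx) (hl a x hx), ?_⟩
      simp [add_mul, Unitization.inl_mul_inr]
  have hJr : ∀ b : Unitization ℂ A, ∀ x ∈ J, x * b ∈ J := by
    rintro b _ ⟨x, hx, rfl⟩
    induction b with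
    | inl_add_inr r a =>
      refine ⟨r • x + x * a, I.add_mem (I.smul_mem r hx) (hr a x hx), ?_⟩
      simp [mul_add, Unitization.inr_mul_inl]
  have key : ∀ i : Finset A × ℕ, ∃ e ∈ I, ‖e‖ ≤ 1 ∧
      (∀ x z, ‖e * x * e + (z - e * z - z * e + e * z * e)‖ ≤ max ‖x‖ ‖z‖) ∧
      (∀ y ∈ i.1, y ∈ I → ‖y - e * y‖ ≤ 1 / ((i.2 : ℝ) + 1)) ∧
      ∀ a ∈ i.1, ‖a * e - e * a‖ ≤ 1 / ((i.2 : ℝ) + 1) := by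
    rintro ⟨F, n⟩
    obtain ⟨_, ⟨e, he, rfl⟩, he0, he1, heF, hec⟩ :=
      CStarAlgebra.exists_quasicentral_approx_unit J hJl hJr
        (F.image ((↑) : A → Unitization ℂ A)) (ε := 1 / ((n : ℝ) + 1)) (by positivity)
    simp only [Unitization.inrHom_apply] at he0 he1 heF hec
    refine ⟨e, he, ?_, fun x z => ?_, fun y hy hyI => ?_, fun a ha => ?_⟩
    · rw [← Unitization.norm_inr (𝕜 := ℂ)]
      exact (CStarAlgebra.norm_le_one_iff_of_nonneg _ he0).2 he1
    · have h := CStarAlgebra.norm_conjugate_add_conjugate_le_max he0 he1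
        (x : Unitization ℂ A) (z : Unitization ℂ A)
      have h1 : (e : Unitization ℂ A) * x * e + (1 - e) * z * (1 - e) =
          ((e * x * e + (z - e * z - z * e + e * z * e) : A) : Unitization ℂ A) := by
        simp only [Unitization.inr_add, Unitization.inr_sub, Unitization.inr_mul]
        noncomm_ring
      rwa [h1, Unitization.norm_inr, Unitization.norm_inr, Unitization.norm_inr] at h
    · have h := heF y (Finset.mem_image_of_mem _ hy) ((hJ y).2 hyI)
      rwa [← Unitization.inr_mul, ← Unitization.inr_sub, Unitization.norm_inr] at h
    · have h := hec a (Finset.mem_image_of_mem _ ha)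
      rwa [← Unitization.inr_mul, ← Unitization.inr_mul, ← Unitization.inr_sub,
        Unitization.norm_inr] at h
  choose e heI hen hemax heF hec using key
  have hlim : Tendsto (fun i : Finset A × ℕ => 1 / ((i.2 : ℝ) + 1)) atTop (𝓝 0) := by
    rw [← prod_atTop_atTop_eq]
    exact tendsto_one_div_add_atTop_nhds_zero_nat.comp tendsto_snd
  have hmem : ∀ a : A, ∀ᶠ i : Finset A × ℕ in atTop, a ∈ i.1 := fun a =>
    (eventually_ge_atTop (({a}, 0) : Finset A × ℕ)).mono fun i hi =>
      Finset.singleton_subset_iff.1 hi.1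
  refine ⟨e, heI, hen, hemax, fun y hy => ?_, fun a => ?_⟩
  · rw [tendsto_iff_norm_sub_tendsto_zero]
    refine squeeze_zero' (Eventually.of_forall fun _ => norm_nonneg _)
      ((hmem y).mono fun i hi => ?_) hlim
    rw [norm_sub_rev]
    exact heF i y hi hy
  · exact squeeze_zero_norm' ((hmem a).mono fun i hi => hec i a hi) hlim

/-! ### Elementary operators and the main theorem -/

theorem tendsto_zero_of_mem_closure {ι E : Type*} [SeminormedAddCommGroup E] {l : Filter ι}
    {φ : ι → E → ℝ} {C : ℝ} (hC : 0 < C) (h0 : ∀ i x, 0 ≤ φ i x)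
    (hφ : ∀ i x y, φ i x ≤ φ i y + C * ‖x - y‖) {s : Set E}
    (hs : ∀ x ∈ s, Tendsto (fun i => φ i x) l (𝓝 0)) {x : E} (hx : x ∈ closure s) :
    Tendsto (fun i => φ i x) l (𝓝 0) := by
  rw [Metric.tendsto_nhds]
  intro ε hε
  obtain ⟨y, hy, hxy⟩ := Metric.mem_closure_iff.1 hx (ε / (2 * C)) (by positivity)
  filter_upwards [Metric.tendsto_nhds.1 (hs y hy) (ε / 2) (by positivity)] with i hi
  rw [Real.dist_0_eq_abs, abs_of_nonneg (h0 _ _)] at hi ⊢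
  rw [dist_eq_norm, lt_div_iff₀ (by positivity)] at hxy
  linarith [hφ i x y]

/-- Multiplication by a quasi-central bounded net commutes asymptotically with elementary
operators. -/
theorem IsElementaryOperator.tendsto_sub {𝕜 A ι : Type*} [NormedField 𝕜] [NonUnitalNormedRing A]
    [NormedSpace 𝕜 A] {T : A →ₗ[𝕜] A} (hT : IsElementaryOperator T) {l : Filter ι} {e : ι → A}
    (hen : ∀ i, ‖e i‖ ≤ 1) (hec : ∀ a, Tendsto (fun i => a * e i - e i * a) l (𝓝 0)) (x : A) :
    Tendsto (fun i => e i * T x - T (e i * x)) l (𝓝 0) ∧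
    Tendsto (fun i => T x * e i - T (x * e i)) l (𝓝 0) ∧
    Tendsto (fun i => e i * T x * e i - T (e i * x * e i)) l (𝓝 0) := by
  obtain ⟨N, a, b, hT⟩ := hT
  have lim : ∀ (f : ι → A) (g : Fin N → ι → A),
      (∀ i, f i = ∑ j, g j i) → (∀ j, Tendsto (g j) l (𝓝 0)) → Tendsto f l (𝓝 0) :=
    fun f g hf hg => by
      rw [funext hf]
      simpa using tendsto_finsetSum Finset.univ fun j _ => hg j
  refine ⟨lim _ (fun j i => (e i * a j - a j * e i) * (x * b j)) (fun i => ?_) fun j => ?_,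
    lim _ (fun j i => a j * x * (b j * e i - e i * b j)) (fun i => ?_) fun j => ?_,
    lim _ (fun j i => (e i * a j - a j * e i) * (x * b j) * e i +
      a j * (e i * (x * (b j * e i - e i * b j)))) (fun i => ?_) fun j => ?_⟩
  · rw [hT, hT, Finset.mul_sum, ← Finset.sum_sub_distrib]
    exact Finset.sum_congr rfl fun j _ => by simp only [sub_mul, mul_assoc]
  · simpa using (hec (a j)).neg.mul_const (x * b j)
  · rw [hT, hT, Finset.sum_mul, ← Finset.sum_sub_distrib]
    exact Finset.sum_congr rfl fun j _ => by simp only [mul_sub, mul_assoc]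
  · simpa using (hec (b j)).const_mul (a j * x)
  · rw [hT, hT, Finset.mul_sum, Finset.sum_mul, ← Finset.sum_sub_distrib]
    refine Finset.sum_congr rfl fun j _ => ?_
    simp only [sub_mul, mul_sub, mul_assoc]
    abel
  · have hb : IsBoundedUnder (· ≤ ·) l (fun i => ‖e i‖) := isBoundedUnder_of ⟨1, hen⟩
    have h1 : Tendsto (fun i => (e i * a j - a j * e i) * (x * b j)) l (𝓝 0) := by
      simpa using (hec (a j)).neg.mul_const (x * b j)
    have h2 : Tendsto (fun i => x * (b j * e i - e i * b j)) l (𝓝 0) := by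
      simpa using (hec (b j)).const_mul x
    have h3 : Tendsto (fun i => e i * (x * (b j * e i - e i * b j))) l (𝓝 0) :=
      isBoundedUnder_le_mul_tendsto_zero hb h2
    simpa using (h1.zero_mul_isBoundedUnder_le hb).add (h3.const_mul (a j))

/-- `I` is a two-sided ideal of the algebra `A`, not assumed to be closed. -/
theorem mainTheorem2 {A : Type*} [NonUnitalCStarAlgebra A] (I : Submodule ℂ A)
    (hI_left : ∀ a : A, ∀ x ∈ I, a * x ∈ I) (hI_right : ∀ a : A, ∀ x ∈ I, x * a ∈ I)
    (T : A →ₗ[ℂ] A) (hT : IsElementaryOperator T) :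
    IsMIdealIn (I.map T).topologicalClosure (LinearMap.range T).topologicalClosure := by
  classical
  obtain ⟨e, heI, hen, hemax, heu, hec⟩ :=
    CStarAlgebra.exists_quasicentral_net I hI_left hI_right
  set Y := (I.map T).topologicalClosure
  have hTY : ∀ x ∈ I, T x ∈ Y := fun x hx =>
    (I.map T).le_topologicalClosure (Submodule.mem_map_of_mem hx)
  let M := ContinuousLinearMap.mul ℂ A
  let S : Finset A × ℕ → A →L[ℂ] A := fun i => M (e i) ∘L M.flip (e i)
  let R : Finset A × ℕ → A →L[ℂ] A := fun i =>
    ContinuousLinearMap.id ℂ A - M (e i) - M.flip (e i) + S i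
  have hS : ∀ i x, S i x = e i * x * e i := fun i x => by simp [S, M, mul_assoc]
  have hR : ∀ i x, R i x = x - e i * x - x * e i + e i * x * e i := fun i x => by
    simp [R, hS, M]
  have hSR : ∀ i x z, ‖S i x + R i z‖ ≤ max ‖x‖ ‖z‖ := fun i x z => by
    rw [hS, hR]; exact hemax i x z
  have hSn : ∀ i x, ‖S i x‖ ≤ ‖x‖ := fun i x => by simpa using hSR i x 0
  have hRn : ∀ i x, ‖R i x‖ ≤ ‖x‖ := fun i x => by simpa using hSR i 0 x
  -- approximation by elements of `T(I)` only needs to be checked on the range of `T`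
  have approx : ∀ V : Finset A × ℕ → A →L[ℂ] A, (∀ i x, ‖V i x‖ ≤ 2 * ‖x‖) →
      (∀ x, ∃ u : Finset A × ℕ → A, (∀ i, u i ∈ I) ∧
        Tendsto (fun i => V i (T x) - T (u i)) atTop (𝓝 0)) →
      ∀ x ∈ (LinearMap.range T).topologicalClosure,
        Tendsto (fun i => Metric.infDist (V i x) (Y : Set A)) atTop (𝓝 0) := by
    intro V hV hu x hx
    refine tendsto_zero_of_mem_closure (φ := fun i x => Metric.infDist (V i x) (Y : Set A))
      two_pos (fun _ _ => Metric.infDist_nonneg) (fun i x y => ?_) ?_ hx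
    · refine Metric.infDist_le_infDist_add_dist.trans (add_le_add le_rfl ?_)
      rw [dist_eq_norm, ← map_sub]
      exact hV i _
    · rintro _ ⟨x, rfl⟩
      obtain ⟨u, huI, hu⟩ := hu x
      refine squeeze_zero (fun _ => Metric.infDist_nonneg) (fun i => ?_) (by simpa using hu.norm)
      rw [← dist_eq_norm]
      exact Metric.infDist_le_dist_of_mem (hTY _ (huI i))
  refine isMIdealIn_of_asymptotic_decomposition (l := atTop) (S := S) (R := R)
    (I.map T).isClosed_topologicalClosure
    (Submodule.topologicalClosure_mono (LinearMap.map_le_range)) hSR ?_ ?_ ?_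
  · refine approx S (fun i x => (hSn i x).trans (by linarith [norm_nonneg x])) fun x =>
      ⟨fun i => e i * x * e i, fun i => hI_right _ _ (hI_right _ _ (heI i)), ?_⟩
    simpa only [hS] using (hT.tendsto_sub hen hec x).2.2
  · refine approx (fun i => ContinuousLinearMap.id ℂ A - R i) (fun i x => ?_) fun x =>
      ⟨fun i => e i * x + x * e i - e i * x * e i, fun i => I.sub_mem (I.add_mem
        (hI_right _ _ (heI i)) (hI_left _ _ (heI i))) (hI_right _ _ (hI_right _ _ (heI i))), ?_⟩
    · calc ‖x - R i x‖ ≤ ‖x‖ + ‖R i x‖ := norm_sub_le _ _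
        _ ≤ 2 * ‖x‖ := by linarith [hRn i x]
    · obtain ⟨h1, h2, h3⟩ := hT.tendsto_sub hen hec x
      have h := (h1.add h2).sub h3
      simp only [add_zero, sub_zero] at h
      refine h.congr fun i => ?_
      simp only [sub_apply, ContinuousLinearMap.id_apply, hR, map_add, map_sub]
      abel
  · intro y hy
    rw [tendsto_iff_norm_sub_tendsto_zero]
    refine tendsto_zero_of_mem_closure (φ := fun i y => ‖S i y - y‖) (s := (I : Set A)) two_pos
      (fun _ _ => norm_nonneg _) (fun i x y => ?_) (fun y hy => ?_) ?_
    · have h1 : S i x - x = (S i y - y) + (S i (x - y) - (x - y)) := by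
        rw [map_sub]; abel
      rw [h1]
      have := hSn i (x - y)
      linarith [norm_add_le (S i y - y) (S i (x - y) - (x - y)),
        norm_sub_le (S i (x - y)) (x - y)]
    · have hb : IsBoundedUnder (· ≤ ·) atTop (fun i => ‖e i‖) := isBoundedUnder_of ⟨1, hen⟩
      -- `e y e - y = (e y - y) e + (y e - e y) + (e y - y)`: quasi-centrality lets a left
      -- approximate unit suffice.
      have h1 : Tendsto (fun i => (e i * y - y) * e i) atTop (𝓝 0) := by
        refine Tendsto.zero_mul_isBoundedUnder_le ?_ hb
        simpa using (heu y hy).sub_const y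
      have h2 := ((h1.add (hec y)).add ((heu y hy).sub_const y)).norm
      simp only [sub_self, add_zero, norm_zero] at h2
      refine h2.congr fun i => ?_
      rw [hS, sub_mul]
      congr 1
      abel
    -- `T` maps `I` into `I`, so `Y` lies in the closure of `I`.
    · obtain ⟨N, a, b, hT⟩ := hT
      refine closure_mono ?_ hy
      rintro _ ⟨x, hx, rfl⟩
      rw [hT]
      exact I.sum_mem fun j _ => hI_right _ _ (hI_left _ _ hx)
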